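/- Let $d\ge 2$ and let $\mathbb{T}_d$ be the homogeneous tree in which every vertex has $d+1$ neighbours. In the self-avoiding frog model on $\mathbb{T}_d$ with parameter $p\in(0,1)$ there is one particle at each vertex; at time $0$ only the particle at the root is active. When it is activated, a particle starts a self-avoiding random walk from its vertex (each jump goes to a uniformly chosen neighbour of the current position that the walk has not yet visited), makes a geometric number of jumps (exactly $k$ jumps with probability $(1-p)p^k$, $k\ge 0$) and is then removed; all walks and lifetimes are independent. An inactive particle becomes active when an active particle jumps to its vertex. The model survives if at every time there is at least one active particle. Let $$p_c^{\mathrm{sa}}(d)=\inf\{p\in(0,1):\text{the model survives with positive probability}\}.$$ For every $d\in\{2,3,4,\dots\}$ the set in this definition is non-empty. Moreover $$p_c^{\mathrm{sa}}(2)\le 0.648046,$$ and for every $d\ge 3$, with $c=\frac{d}{d+1}$ and $F(c,d)=7d(c+1)^3-8c^2$, $$p_c^{\mathrm{sa}}(d)\le (d+1)^2\,\frac{F(c,d)-\sqrt{F(c,d)^2-224\,c^2(c+1)^2}}{16\,d}.$$ These bounds improve the earlier bound $\frac{2d+1-\sqrt{4d^2-3}}{2}$: $0.648046$ is strictly smaller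 than its value at $d=2$, and for every $d\ge3$ the right-hand side of the last display is strictly smaller than it. -/

import Mathlib

open MeasureTheory ProbabilityTheory

/-! ### The homogeneous tree -/

/-- Vertices of the homogeneous tree of degree `d + 1`: words over an alphabet with `d + 1` letters
in which consecutive letters are distinct. -/
@[ext]
structure TreeVertex (d : ℕ) : Type where
  /-- The word. -/
  word : List (Fin (d + 1))
  isChain : word.IsChain (fun a b => a ≠ b)

instance TreeVertex.instCountable (d : ℕ) : Countable (TreeVertex d) :=
  Function.Injective.countable (f := TreeVertex.word) (fun _ _ h => TreeVertex.ext h)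

instance TreeVertex.instMeasurableSpace (d : ℕ) : MeasurableSpace (TreeVertex d) := ⊤

instance TreeVertex.instDiscreteMeasurableSpace (d : ℕ) :
    DiscreteMeasurableSpace (TreeVertex d) := ⟨fun _ => trivial⟩

/-- The root of the tree: the empty word. -/
def treeRoot (d : ℕ) : TreeVertex d := ⟨[], List.isChain_nil⟩

/-- The homogeneous tree of degree `d + 1`: two words are adjacent iff one of them is obtained from
the other one by putting one letter in front of it. -/
def homTree (d : ℕ) : SimpleGraph (TreeVertex d) where
  Adj v w := (∃ a, w.word = a :: v.word) ∨ (∃ a, v.word = a :: w.word)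
  symm := ⟨fun _ _ h => h.symm⟩
  loopless := ⟨fun v h => by
    rcases h with ⟨a, h⟩ | ⟨a, h⟩ <;> simpa using congrArg List.length h⟩

/-- Every vertex of `homTree d` has exactly `d + 1` neighbours. -/
theorem homTree_ncard_neighborSet (d : ℕ) (v : TreeVertex d) :
    ((homTree d).neighborSet v).ncard = d + 1 := by
  classical
  -- the neighbour of `v` in the direction of the letter `a`
  let f : Fin (d + 1) → TreeVertex d := fun a =>
    if h : v.word.head? = some a then ⟨v.word.tail, v.isChain.tail⟩
    else ⟨a :: v.word, List.isChain_cons.2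
      ⟨fun b hb hab => h (by rw [hab]; exact hb), v.isChain⟩⟩
  have hf1 : ∀ a, v.word.head? = some a → (f a).word = v.word.tail := fun a h => by simp [f, h]
  have hf2 : ∀ a, v.word.head? ≠ some a → (f a).word = a :: v.word := fun a h => by simp [f, h]
  have hf : Function.Injective f := by
    intro a a' h
    have hw := congrArg TreeVertex.word h
    have hlen := congrArg List.length hw
    by_cases h1 : v.word.head? = some a <;> by_cases h2 : v.word.head? = some a'
    · exact Option.some.inj (h1.symm.trans h2)
    · rw [hf1 a h1, hf2 a' h2, List.length_tail, List.length_cons] at hlen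
      omega
    · rw [hf2 a h1, hf1 a' h2, List.length_tail, List.length_cons] at hlen
      omega
    · rw [hf2 a h1, hf2 a' h2] at hw
      exact (List.cons.inj hw).1
  have hr : (homTree d).neighborSet v = Set.range f := by
    ext w
    constructor
    · rintro (⟨a, h⟩ | ⟨a, h⟩)
      · have hne : v.word.head? ≠ some a := by
          have hc := w.isChain
          rw [h, List.isChain_cons] at hc
          exact fun h' => hc.1 a h' rfl
        exact ⟨a, TreeVertex.ext ((hf2 a hne).trans h.symm)⟩
      · exact ⟨a, TreeVertex.ext ((hf1 a (by rw [h]; rfl)).trans (by rw [h]; rfl))⟩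
    · rintro ⟨a, rfl⟩
      by_cases h1 : v.word.head? = some a
      · refine Or.inr ⟨a, ?_⟩
        rw [hf1 a h1]
        exact (List.cons_head?_tail h1).symm
      · exact Or.inl ⟨a, hf2 a h1⟩
  rw [hr, ← Set.image_univ, Set.ncard_image_of_injective _ hf, Set.ncard_univ]
  simp

/-- `homTree d` is a tree. -/
theorem homTree_isTree (d : ℕ) : (homTree d).IsTree := by
  have hreach : ∀ (l : List (Fin (d + 1))) (hl : l.IsChain (fun a b => a ≠ b)),
      (homTree d).Reachable (treeRoot d) ⟨l, hl⟩ := by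
    intro l
    induction l with
    | nil => exact fun _ => SimpleGraph.Reachable.refl _
    | cons a t ih =>
      intro hl
      exact (ih hl.tail).trans (SimpleGraph.Adj.reachable (Or.inl ⟨a, rfl⟩))
  have hbridge : ∀ (v w : TreeVertex d) (a : Fin (d + 1)), w.word = a :: v.word →
      ¬ ((homTree d).deleteEdges {s(v, w)}).Reachable w v := by
    intro v w a hw
    have hstep : ∀ x y : TreeVertex d, ((homTree d).deleteEdges {s(v, w)}).Adj x y →
        w.word <:+ x.word → w.word <:+ y.word := by
      intro x y hxy hx
      rw [SimpleGraph.deleteEdges_adj] at hxy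
      obtain ⟨hadj, hne⟩ := hxy
      rcases hadj with ⟨b, h⟩ | ⟨b, h⟩
      · rw [h]
        exact hx.trans (List.suffix_cons b x.word)
      · rw [h, List.suffix_cons_iff] at hx
        rcases hx with hx | hx
        · exfalso
          have hxw : x = w := TreeVertex.ext (h.trans hx.symm)
          have hyv : y = v := by
            rw [hw, List.cons.injEq] at hx
            exact TreeVertex.ext hx.2.symm
          exact hne (by simp [hxw, hyv, Sym2.eq_swap])
        · exact hx
    rintro ⟨q⟩
    have hq : ∀ (x y : TreeVertex d) (_ : ((homTree d).deleteEdges {s(v, w)}).Walk x y),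
        w.word <:+ x.word → w.word <:+ y.word := by
      intro x y q
      induction q with
      | nil => exact id
      | cons h _ ih => exact fun hx => ih (hstep _ _ h hx)
    have hlen := (hq w v q List.suffix_rfl).length_le
    rw [hw] at hlen
    simp at hlen
  refine ⟨(SimpleGraph.connected_iff_exists_forall_reachable _).2
    ⟨treeRoot d, fun v => hreach v.word v.isChain⟩, ?_⟩
  rw [SimpleGraph.isAcyclic_iff_forall_adj_isBridge]
  intro v w hvw
  rw [SimpleGraph.isBridge_iff]
  rcases hvw with ⟨a, h⟩ | ⟨a, h⟩
  · exact fun hr => hbridge v w a h hr.symm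
  · rw [Sym2.eq_swap]
    exact fun hr => hbridge w v a h hr

/-! ### Self-avoiding random walk -/

section Walk

variable {V : Type*} (G : SimpleGraph V)

/-- The neighbours of the current position `x n` that have not been visited by the path
`x 0, …, x n`. -/
def freshNeighbors (n : ℕ) (x : Finset.Iic n → V) : Set V :=
  {w | G.Adj (x ⟨n, Finset.mem_Iic.2 le_rfl⟩) w ∧ ∀ i, x i ≠ w}

variable [MeasurableSpace V]

open Classical in
/-- The law of the next position of the self-avoiding random walk after the path `x 0, …, x n`:
uniform on the unvisited neighbours of `x n` (and the walk stays at `x n` if there is no uniform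
law on that set, which never happens along a self-avoiding path of `homTree d` if `d ≥ 1`). -/
noncomputable def sawStep (n : ℕ) (x : Finset.Iic n → V) : Measure V :=
  if (freshNeighbors G n x).Finite ∧ (freshNeighbors G n x).Nonempty then
    uniformOn (freshNeighbors G n x)
  else Measure.dirac (x ⟨n, Finset.mem_Iic.2 le_rfl⟩)

variable [DiscreteMeasurableSpace V] [Countable V]

/-- `sawStep` as a Markov kernel from the past to the next position. -/
noncomputable def sawKernel (n : ℕ) : Kernel (Finset.Iic n → V) V :=
  Kernel.ofFunOfCountable (sawStep G n)

instance sawKernel.instIsMarkovKernel (n : ℕ) : IsMarkovKernel (sawKernel G n) := by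
  refine ⟨fun x => ?_⟩
  change IsProbabilityMeasure (sawStep G n x)
  unfold sawStep
  split_ifs with h
  · exact isProbabilityMeasure_uniformOn h.1 h.2
  · infer_instance

/-- The law of the whole trajectory of the self-avoiding random walk on `G` started at `v`. -/
noncomputable def sawLaw (v : V) : Measure (ℕ → V) :=
  Kernel.traj (X := fun _ => V) (sawKernel G) 0 (fun _ => v)

instance sawLaw.instIsProbabilityMeasure (v : V) : IsProbabilityMeasure (sawLaw G v) := by
  unfold sawLaw
  infer_instance

end Walk

/-! ### The frog model -/

/-- The status of a particle: inactive, active and having made `k` jumps so far, or removed. -/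
inductive FrogStatus : Type
  | inactive : FrogStatus
  | active (k : ℕ) : FrogStatus
  | removed : FrogStatus

section Frog

variable {V : Type*}

open Classical in
/-- The status at time `t` of the particle that starts at vertex `v`. Each vertex carries one
particle; the particle of `u` has trajectory `(ω u).1` (starting at `u`) and makes `(ω u).2` jumps
before it is removed. At time `0` only the particle of the vertex `o` is active. An inactive
particle becomes active when an active particle jumps to its vertex. -/
noncomputable def frogStatus (o : V) (ω : V → (ℕ → V) × ℕ) : ℕ → V → FrogStatus
  | 0, v => if v = o then .active 0 else .inactive
  | t + 1, v =>
    match frogStatus o ω t v with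
    | .inactive =>
      if ∃ u k, frogStatus o ω t u = .active k ∧ k < (ω u).2 ∧ (ω u).1 (k + 1) = v then
        .active 0
      else .inactive
    | .active k => if k < (ω v).2 then .active (k + 1) else .removed
    | .removed => .removed

/-- The frog model survives: at every time there is at least one active particle. -/
def FrogSurvives (o : V) (ω : V → (ℕ → V) × ℕ) : Prop :=
  ∀ t, ∃ v k, frogStatus o ω t v = .active k

variable [MeasurableSpace V] [DiscreteMeasurableSpace V] [Countable V]

/-- The law of the randomness of the self-avoiding frog model on `G`: all trajectories and all
lifetimes are independent, the trajectory of the particle of `v` is a self-avoiding random walk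
started at `v`, and the lifetimes are geometric with parameter `1 - p`, that is, the lifetime
is `k` with probability `(1 - p) * p ^ k`. -/
noncomputable def safLaw (G : SimpleGraph V) (p : unitInterval) : Measure (V → (ℕ → V) × ℕ) :=
  Measure.infinitePi (fun v => (sawLaw G v).prod (geometricMeasure (unitInterval.symm p)))

/-- The survival probability of the self-avoiding frog model on `G`, with one particle per vertex
and initially only the particle of `o` active. -/
noncomputable def safSurvivalProb (G : SimpleGraph V) (o : V) (p : unitInterval) : ℝ :=
  (safLaw G p).real {ω | FrogSurvives o ω}

end Frog

/-- The set of all `p ∈ (0, 1)` for which the self-avoiding frog model on the homogeneous tree of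
degree `d + 1` survives with positive probability. -/
def safSurvivalSet (d : ℕ) : Set ℝ :=
  {x | ∃ p : unitInterval, (p : ℝ) = x ∧ 0 < p ∧ p < 1 ∧
    0 < safSurvivalProb (homTree d) (treeRoot d) p}

/-- The critical parameter of the self-avoiding frog model on the homogeneous tree of degree
`d + 1`. -/
noncomputable def safCriticalParam (d : ℕ) : ℝ := sInf (safSurvivalSet d)

/-! ### The explicit bounds -/

/-- `F(c, d) = 7 d (c + 1) ^ 3 - 8 c ^ 2`. -/
noncomputable def boundF (c d : ℝ) : ℝ := 7 * d * (c + 1) ^ 3 - 8 * c ^ 2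

/-- The new upper bound, with `c = d / (d + 1)`. -/
noncomputable def newBound (d : ℝ) : ℝ :=
  let c : ℝ := d / (d + 1)
  (d + 1) ^ 2 * (boundF c d - √(boundF c d ^ 2 - 224 * c ^ 2 * (c + 1) ^ 2)) / (16 * d)

/-- The previously known upper bound. -/
noncomputable def oldBound (d : ℝ) : ℝ := (2 * d + 1 - √(4 * d ^ 2 - 3)) / 2

/-!
Only jumps away from the root are used. On a fixed descending path, decompose the event that the
`n`-th particle gets activated according to the last particle which reaches the `n`-th vertex by
following the path. Multiplying by the number `d ^ n` of paths turns this into a renewal inequality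
for the expected number `a n` of activated descendants `n` generations below. If its weights have
total mass greater than `1`, then `a n ≥ 2` for some `n`. The descendants activated in this way form
a branching process with mean offspring at least `2`, except that siblings are dependent, so
independence is replaced by a second moment bound in which each of the offspring is weighted by the
inverse of the probability that it has descendants in generation `k`. By induction on `k`, it
follows that generation `k` is nonempty with probability at least `d⁻ⁿ`, for all `k`. Hence
infinitely many particles are activated with positive probability, and since every particle is
removed eventually, the process never dies out.
-/

/-! ### Descending paths -/

section Tree

variable {d : ℕ}

theorem TreeVertex.isChain_succAbove_cons (v : TreeVertex d) (i : Fin d) :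
    ((v.word.headD 0).succAbove i :: v.word).IsChain (fun a b => a ≠ b) := by
  refine List.isChain_cons.2 ⟨fun b hb => ?_, v.isChain⟩
  have hhead : v.word.headD 0 = b := by
    rw [List.headD_eq_head?_getD, Option.mem_def.1 hb, Option.getD_some]
  exact hhead ▸ Fin.succAbove_ne _ i

/-- The child of `v` with label `i`. The first letter of `v` is not available for its children,
which is why `succAbove` skips it; of the `d + 1` children of the root, only the `d` whose letter
is not `0` are of this form. -/
def TreeVertex.child (v : TreeVertex d) (i : Fin d) : TreeVertex d :=
  ⟨(v.word.headD 0).succAbove i :: v.word, v.isChain_succAbove_cons i⟩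

theorem TreeVertex.word_child (v : TreeVertex d) (i : Fin d) :
    (v.child i).word = (v.word.headD 0).succAbove i :: v.word := rfl

theorem TreeVertex.child_inj {v w : TreeVertex d} {i j : Fin d} :
    v.child i = w.child j ↔ v = w ∧ i = j := by
  refine ⟨fun h => ?_, fun ⟨hv, hi⟩ => hv ▸ hi ▸ rfl⟩
  obtain ⟨hletter, hword⟩ := List.cons.inj (congrArg TreeVertex.word h)
  obtain rfl : v = w := TreeVertex.ext hword
  exact ⟨rfl, Fin.succAbove_right_injective hletter⟩

/-- The path that descends from `v` through the children with labels `f 0, f 1, …`. -/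
def descPath (v : TreeVertex d) (f : ℕ → Fin d) : ℕ → TreeVertex d
  | 0 => v
  | n + 1 => (descPath v f n).child (f n)

theorem descPath_succ (v : TreeVertex d) (f : ℕ → Fin d) (n : ℕ) :
    descPath v f (n + 1) = (descPath v f n).child (f n) := rfl

theorem descPath_add (v : TreeVertex d) (f : ℕ → Fin d) (m n : ℕ) :
    descPath v f (m + n) = descPath (descPath v f m) (fun j => f (m + j)) n := by
  induction n with
  | zero => rfl
  | succ n ih => rw [← add_assoc, descPath_succ, descPath_succ, ih]

theorem length_word_descPath (v : TreeVertex d) (f : ℕ → Fin d) (n : ℕ) :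
    (descPath v f n).word.length = v.word.length + n := by
  induction n with
  | zero => rfl
  | succ n ih => rw [descPath_succ, TreeVertex.word_child, List.length_cons, ih, add_assoc]

theorem descPath_injective (v : TreeVertex d) (f : ℕ → Fin d) :
    Function.Injective (descPath v f) := fun m n h => by
  simpa only [length_word_descPath, add_right_inj] using congrArg (fun w => w.word.length) h

theorem word_suffix_word_descPath (v : TreeVertex d) (f : ℕ → Fin d) (n : ℕ) :
    v.word <:+ (descPath v f n).word := by
  induction n with
  | zero => exact List.suffix_rfl
  | succ n ih => exact ih.trans (List.suffix_cons _ _)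

theorem eq_of_descPath_eq (v : TreeVertex d) {f g : ℕ → Fin d} {n : ℕ}
    (h : descPath v f n = descPath v g n) : ∀ j < n, f j = g j := by
  induction n with
  | zero => exact fun j hj => absurd hj j.not_lt_zero
  | succ n ih =>
    obtain ⟨hpath, hlabel⟩ := TreeVertex.child_inj.1 h
    exact Nat.forall_lt_succ_right.2 ⟨ih hpath, hlabel⟩

theorem homTree_adj_descPath (v : TreeVertex d) (f : ℕ → Fin d) (n : ℕ) :
    (homTree d).Adj (descPath v f n) (descPath v f (n + 1)) :=
  Or.inl ⟨_, rfl⟩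

theorem descPath_succ_mem_freshNeighbors (v : TreeVertex d) (f : ℕ → Fin d) (n : ℕ) :
    descPath v f (n + 1) ∈
      freshNeighbors (homTree d) n (Preorder.frestrictLe n (descPath v f)) := by
  refine ⟨homTree_adj_descPath v f n, fun ⟨i, hi⟩ hvisited => ?_⟩
  rw [Finset.mem_Iic] at hi
  have : i = n + 1 := descPath_injective v f hvisited
  omega

theorem freshNeighbors_descPath_zero (v : TreeVertex d) (f : ℕ → Fin d) :
    freshNeighbors (homTree d) 0 (Preorder.frestrictLe 0 (descPath v f)) =
      (homTree d).neighborSet v := by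
  ext w
  refine ⟨fun h => h.1, fun h => ⟨h, fun ⟨i, hi⟩ => ?_⟩⟩
  obtain rfl : i = 0 := by simpa using hi
  exact SimpleGraph.Adj.ne ((SimpleGraph.mem_neighborSet _ _ _).1 h)

theorem freshNeighbors_descPath_succ (v : TreeVertex d) (f : ℕ → Fin d) (n : ℕ) :
    freshNeighbors (homTree d) (n + 1) (Preorder.frestrictLe (n + 1) (descPath v f)) =
      (homTree d).neighborSet (descPath v f (n + 1)) \ {descPath v f n} := by
  ext w
  refine ⟨fun ⟨hadj, hfresh⟩ => ⟨hadj, fun h => hfresh ⟨n, by simp⟩ h.symm⟩,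
    fun ⟨hadj, hne⟩ => ⟨hadj, ?_⟩⟩
  rintro ⟨i, hi⟩ (rfl : descPath v f i = w)
  rw [Finset.mem_Iic] at hi
  rcases hadj with ⟨a, hdown⟩ | ⟨a, hup⟩
  · have hlength := congrArg List.length hdown
    simp only [length_word_descPath, List.length_cons] at hlength
    omega
  · rw [descPath_succ, TreeVertex.word_child, List.cons.injEq] at hup
    exact hne (TreeVertex.ext hup.2.symm)

theorem ncard_freshNeighbors_descPath_succ (v : TreeVertex d) (f : ℕ → Fin d) (n : ℕ) :
    (freshNeighbors (homTree d) (n + 1)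
      (Preorder.frestrictLe (n + 1) (descPath v f))).ncard = d := by
  have hparent : descPath v f n ∈ (homTree d).neighborSet (descPath v f (n + 1)) :=
    (homTree_adj_descPath v f n).symm
  rw [freshNeighbors_descPath_succ, Set.ncard_sdiff_singleton_of_mem hparent,
    homTree_ncard_neighborSet, Nat.add_sub_cancel]

theorem finite_freshNeighbors_homTree (n : ℕ) (x : Finset.Iic n → TreeVertex d) :
    (freshNeighbors (homTree d) n x).Finite := by
  have hfin : ((homTree d).neighborSet (x ⟨n, Finset.mem_Iic.2 le_rfl⟩)).Finite :=
    Set.finite_of_ncard_ne_zero (by rw [homTree_ncard_neighborSet]; exact d.succ_ne_zero)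
  exact hfin.subset fun _ hw => hw.1

end Tree

section Walk

theorem uniformOn_singleton_of_mem {Ω : Type*} [MeasurableSpace Ω] [MeasurableSingletonClass Ω]
    {s : Set Ω} (hs : s.Finite) {a : Ω} (ha : a ∈ s) :
    uniformOn s {a} = (s.ncard : ENNReal)⁻¹ := by
  rw [uniformOn, cond_apply hs.measurableSet, Set.inter_eq_right.2 (Set.singleton_subset_iff.2 ha),
    Measure.count_singleton, mul_one, Measure.count_apply_finite _ hs,
    Set.ncard_eq_toFinset_card s hs]

variable {V : Type*}

theorem setOf_forall_le_eq_preimage_frestrictLe (x : ℕ → V) (n : ℕ) :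
    {y : ℕ → V | ∀ l ≤ n, y l = x l} =
      Preorder.frestrictLe (π := fun _ => V) n ⁻¹' {Preorder.frestrictLe n x} := by
  ext y
  simp only [Set.mem_ofPred_eq, Set.mem_preimage, Set.mem_singleton_iff, funext_iff,
    Subtype.forall, Finset.mem_Iic, Preorder.frestrictLe_apply]

variable [MeasurableSpace V]

theorem measurableSet_forall_le_eq [MeasurableSingletonClass V] (x : ℕ → V) (n : ℕ) :
    MeasurableSet {y : ℕ → V | ∀ l ≤ n, y l = x l} := by
  rw [setOf_forall_le_eq_preimage_frestrictLe]
  exact Preorder.measurable_frestrictLe n (measurableSet_singleton _)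

variable [DiscreteMeasurableSpace V]

theorem sawStep_singleton_of_mem (G : SimpleGraph V) {n : ℕ} {x : Finset.Iic n → V} {w : V}
    (hfin : (freshNeighbors G n x).Finite) (hw : w ∈ freshNeighbors G n x) :
    sawStep G n x {w} = ((freshNeighbors G n x).ncard : ENNReal)⁻¹ := by
  rw [sawStep, if_pos ⟨hfin, w, hw⟩, uniformOn_singleton_of_mem hfin hw]

variable [Countable V] (G : SimpleGraph V)

theorem sawLaw_forall_le_zero_eq (x : ℕ → V) : sawLaw G (x 0) {y | ∀ l ≤ 0, y l = x l} = 1 := by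
  have hstart : Preorder.frestrictLe (π := fun _ => V) 0 x = fun _ => x 0 := by
    funext ⟨i, hi⟩
    obtain rfl : i = 0 := by simpa using hi
    rfl
  rw [setOf_forall_le_eq_preimage_frestrictLe, hstart,
    ← Measure.map_apply (by fun_prop) (measurableSet_singleton _), sawLaw,
    Kernel.traj_map_frestrictLe_apply, Kernel.partialTraj_self, Kernel.id_apply,
    Measure.dirac_apply_of_mem (Set.mem_singleton _)]

theorem sawLaw_forall_le_succ_eq (v : V) (x : ℕ → V) (n : ℕ) :
    sawLaw G v {y | ∀ l ≤ n + 1, y l = x l} =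
      sawLaw G v {y | ∀ l ≤ n, y l = x l} *
        sawStep G n (Preorder.frestrictLe n x) {x (n + 1)} := by
  have hsplit : {y : ℕ → V | ∀ l ≤ n + 1, y l = x l} =
      (fun y : ℕ → V => (Preorder.frestrictLe (π := fun _ => V) n y, y (n + 1))) ⁻¹'
        ({Preorder.frestrictLe n x} ×ˢ {x (n + 1)}) := by
    rw [Set.mk_preimage_prod, ← setOf_forall_le_eq_preimage_frestrictLe]
    ext y
    simp only [Set.mem_ofPred_eq, Set.mem_inter_iff, Set.mem_preimage, Set.mem_singleton_iff,
      Nat.le_succ_iff, or_imp, forall_and, forall_eq]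
  rw [hsplit, setOf_forall_le_eq_preimage_frestrictLe, sawLaw,
    ← Measure.map_apply (by fun_prop)
      ((measurableSet_singleton _).prod (measurableSet_singleton _)),
    ← Measure.map_apply (by fun_prop) (measurableSet_singleton _),
    ← Kernel.partialTraj_compProd_eq_map_traj n.zero_le, Kernel.traj_map_frestrictLe_apply,
    Measure.compProd_apply_prod (measurableSet_singleton _) (measurableSet_singleton _),
    lintegral_singleton, mul_comm]
  rfl

theorem sawLaw_homTree_real_descPath {d : ℕ} (v : TreeVertex d) (f : ℕ → Fin d) (n : ℕ) :
    (sawLaw (homTree d) v).real {y | ∀ l ≤ n + 1, y l = descPath v f l} =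
      ((d + 1 : ℝ) * d ^ n)⁻¹ := by
  have hstep (m : ℕ) := sawStep_singleton_of_mem (homTree d)
    (finite_freshNeighbors_homTree m _) (descPath_succ_mem_freshNeighbors v f m)
  have hzero : sawLaw (homTree d) v {y | ∀ l ≤ 0, y l = descPath v f l} = 1 :=
    sawLaw_forall_le_zero_eq _ (descPath v f)
  induction n with
  | zero =>
    rw [measureReal_def, sawLaw_forall_le_succ_eq, hzero, hstep,
      freshNeighbors_descPath_zero, homTree_ncard_neighborSet, one_mul, ENNReal.toReal_inv,
      ENNReal.toReal_natCast, pow_zero, mul_one, Nat.cast_succ]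
  | succ n ih =>
    rw [measureReal_def] at ih ⊢
    rw [sawLaw_forall_le_succ_eq, ENNReal.toReal_mul, ih, hstep,
      ncard_freshNeighbors_descPath_succ, ENNReal.toReal_inv, ENNReal.toReal_natCast, pow_succ,
      ← mul_assoc, mul_inv (_ * _)]

end Walk

theorem geometricMeasure_real_Ici {p : unitInterval} (hp : p ≠ 0) (k : ℕ) :
    (geometricMeasure p).real (Set.Ici k) = (1 - p : ℝ) ^ k := by
  induction k with
  | zero => rw [← bot_eq_zero, Set.Ici_bot, probReal_univ, bot_eq_zero, pow_zero]
  | succ k ih =>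
    have hsplit : ({k} ∪ Set.Ici (k + 1) : Set ℕ) = Set.Ici k := by
      ext m
      simp only [Set.mem_Ici, Set.singleton_union, Set.mem_insert_iff]
      omega
    rw [← hsplit, measureReal_union (by simp) .of_discrete,
      geometricMeasure_real_singleton hp] at ih
    linear_combination ih

/-! ### Activation along a path -/

section Activation

variable {V : Type*} {o : V} {ω : V → (ℕ → V) × ℕ}

/-- The particle of `v` becomes active at some time. -/
def Activated (o : V) (ω : V → (ℕ → V) × ℕ) (v : V) : Prop :=
  ∃ t, frogStatus o ω t v = .active 0

theorem frogStatus_succ_of_active {t k : ℕ} {v : V} (h : frogStatus o ω t v = .active k) :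
    frogStatus o ω (t + 1) v = if k < (ω v).2 then .active (k + 1) else .removed := by
  rw [frogStatus, h]

theorem frogStatus_succ_of_removed {t : ℕ} {v : V} (h : frogStatus o ω t v = .removed) :
    frogStatus o ω (t + 1) v = .removed := by
  rw [frogStatus, h]

open Classical in
theorem frogStatus_succ_of_inactive {t : ℕ} {v : V} (h : frogStatus o ω t v = .inactive) :
    frogStatus o ω (t + 1) v =
      if ∃ u k, frogStatus o ω t u = .active k ∧ k < (ω u).2 ∧ (ω u).1 (k + 1) = v then
        .active 0 else .inactive := by
  rw [frogStatus, h]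

theorem frogStatus_add {t : ℕ} {v : V} (h : frogStatus o ω t v = .active 0) {k : ℕ}
    (hk : k ≤ (ω v).2) : frogStatus o ω (t + k) v = .active k := by
  induction k with
  | zero => exact h
  | succ k ih => rw [← add_assoc, frogStatus_succ_of_active (ih (by omega)), if_pos (by omega)]

theorem frogStatus_ne_inactive_of_le {s t : ℕ} (hst : s ≤ t) {v : V}
    (h : frogStatus o ω s v ≠ .inactive) : frogStatus o ω t v ≠ .inactive := by
  induction t, hst using Nat.le_induction with
  | base => exact h
  | succ t _ ih =>
    rcases hstatus : frogStatus o ω t v with _ | k | _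
    · exact absurd hstatus ih
    · rw [frogStatus_succ_of_active hstatus]
      split_ifs <;> exact nofun
    · rw [frogStatus_succ_of_removed hstatus]
      exact nofun

theorem exists_active_of_le {s t : ℕ} (hst : s ≤ t) {v : V} {k : ℕ}
    (h : frogStatus o ω t v = .active k) : ∃ u j, frogStatus o ω s u = .active j := by
  induction t, hst using Nat.le_induction generalizing v k with
  | base => exact ⟨v, k, h⟩
  | succ t _ ih =>
    rcases hstatus : frogStatus o ω t v with _ | j | _
    · rw [frogStatus_succ_of_inactive hstatus] at h
      split_ifs at h with hjump
      obtain ⟨u, j, hu, -⟩ := hjump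
      exact ih hu
    · exact ih hstatus
    · rw [frogStatus_succ_of_removed hstatus] at h
      exact FrogStatus.noConfusion h

theorem activated_origin (o : V) (ω : V → (ℕ → V) × ℕ) : Activated o ω o :=
  ⟨0, if_pos rfl⟩

theorem Activated.of_ne_inactive {t : ℕ} {v : V} (h : frogStatus o ω t v ≠ .inactive) :
    Activated o ω v := by
  induction t with
  | zero =>
    obtain rfl : v = o := by
      by_contra hv
      exact h (if_neg hv)
    exact activated_origin v ω
  | succ t ih =>
    by_cases hinactive : frogStatus o ω t v = .inactive
    · refine ⟨t + 1, ?_⟩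
      rw [frogStatus_succ_of_inactive hinactive] at h ⊢
      split_ifs at h ⊢
      · rfl
      · exact absurd rfl h
    · exact ih hinactive

theorem Activated.jump {v : V} (h : Activated o ω v) {k : ℕ} (hk : k < (ω v).2) :
    Activated o ω ((ω v).1 (k + 1)) := by
  obtain ⟨t, ht⟩ := h
  by_cases hinactive : frogStatus o ω (t + k) ((ω v).1 (k + 1)) = .inactive
  · refine ⟨t + k + 1, ?_⟩
    rw [frogStatus_succ_of_inactive hinactive, if_pos ⟨v, k, frogStatus_add ht hk.le, hk, rfl⟩]
  · exact .of_ne_inactive hinactive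

theorem finite_setOf_frogStatus_ne_inactive (o : V) (ω : V → (ℕ → V) × ℕ) (t : ℕ) :
    {v | frogStatus o ω t v ≠ .inactive}.Finite := by
  induction t with
  | zero =>
    refine (Set.finite_singleton o).subset fun v hv => ?_
    by_contra hne
    exact hv (if_neg hne)
  | succ t ih =>
    let target : V → V := fun u => match frogStatus o ω t u with
      | .active k => (ω u).1 (k + 1)
      | _ => u
    refine (ih.union (ih.image target)).subset fun v (hv : frogStatus o ω (t + 1) v ≠ _) => ?_
    by_cases hinactive : frogStatus o ω t v = .inactive
    · rw [frogStatus_succ_of_inactive hinactive] at hv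
      split_ifs at hv with hjump
      · obtain ⟨u, k, hu, -, huv⟩ := hjump
        have hu' : frogStatus o ω t u ≠ .inactive := by rw [hu]; exact nofun
        exact Or.inr ⟨u, hu', by simp only [target, hu, huv]⟩
      · exact absurd rfl hv
    · exact Or.inl hinactive

theorem frogSurvives_of_infinite (h : {v | Activated o ω v}.Infinite) : FrogSurvives o ω := by
  intro s
  obtain ⟨v, ⟨t, ht⟩, hv⟩ := h.exists_notMem_finite (finite_setOf_frogStatus_ne_inactive o ω s)
  refine exists_active_of_le (le_of_not_ge fun hts => hv ?_) ht
  exact frogStatus_ne_inactive_of_le hts (by rw [ht]; exact nofun)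

/-- The first `k` jumps of the particle of `x i` go along the path `x`. -/
def FollowsPath (ω : V → (ℕ → V) × ℕ) (x : ℕ → V) (i k : ℕ) : Prop :=
  k ≤ (ω (x i)).2 ∧ ∀ l ≤ k, (ω (x i)).1 l = x (i + l)

/-- The particle of `x n` becomes active when the one of `x 0` does, because of particles that
start on the path `x` before `x n` and follow this path. -/
inductive PathActivated (ω : V → (ℕ → V) × ℕ) (x : ℕ → V) : ℕ → Prop
  | zero : PathActivated ω x 0
  | step {i n : ℕ} : i < n → PathActivated ω x i → FollowsPath ω x i (n - i) → PathActivated ω x n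

theorem PathActivated.activated {x : ℕ → V} {n : ℕ} (h : PathActivated ω x n)
    (hx : Activated o ω (x 0)) : Activated o ω (x n) := by
  induction h with
  | zero => exact hx
  | @step i n hin _ hfollows ih =>
    obtain ⟨k, rfl⟩ := Nat.exists_eq_add_of_lt hin
    rw [show i + k + 1 - i = k + 1 by omega] at hfollows
    have hjump := ih.jump (Nat.lt_of_succ_le hfollows.1)
    rwa [hfollows.2 (k + 1) le_rfl] at hjump

end Activation

/-! ### A weighted second moment bound -/

section SecondMoment

variable {Ω κ : Type*}

theorem two_mul_sum_indicator_sub_sum_sum_le [Fintype κ] (F : κ → Set Ω) (u : κ → ℝ) (ω : Ω) :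
    2 * ∑ a, u a * (F a).indicator 1 ω - ∑ a, ∑ b, u a * u b * (F a ∩ F b).indicator 1 ω ≤
      (⋃ a, F a).indicator 1 ω := by
  have hsquare : ∑ a, ∑ b, u a * u b * (F a ∩ F b).indicator 1 ω =
      (∑ a, u a * (F a).indicator 1 ω) ^ 2 := by
    simp only [sq, Finset.sum_mul_sum, Set.inter_indicator_one, Pi.mul_apply, mul_mul_mul_comm]
  rw [hsquare]
  by_cases hω : ω ∈ ⋃ a, F a
  · rw [Set.indicator_of_mem hω, Pi.one_apply]
    nlinarith only [sq_nonneg (∑ a, u a * (F a).indicator 1 ω - 1)]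
  · have hzero (a : κ) : (F a).indicator (1 : Ω → ℝ) ω = 0 :=
      Set.indicator_of_notMem (fun h => hω (Set.mem_iUnion_of_mem a h)) _
    simp [hzero, hω]

variable [MeasurableSpace Ω] {μ : Measure Ω} [IsFiniteMeasure μ] {A E : κ → Set Ω} {δ : ℝ}

theorem inv_mul_inv_mul_measureReal_inter_inter_le [DecidableEq κ] (hδ : 0 < δ)
    (hδE : ∀ a, δ ≤ μ.real (E a))
    (hAE : ∀ a b, μ.real (A a ∩ A b ∩ (E a ∩ E b)) = μ.real (A a ∩ A b) * μ.real (E a ∩ E b))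
    (hEE : Pairwise fun a b => μ.real (E a ∩ E b) = μ.real (E a) * μ.real (E b)) (a b : κ) :
    (μ.real (E a))⁻¹ * (μ.real (E b))⁻¹ * μ.real (A a ∩ E a ∩ (A b ∩ E b)) ≤
      (if a = b then δ⁻¹ * μ.real (A a) else 0) + μ.real (A a) := by
  have ha : 0 < μ.real (E a) := hδ.trans_le (hδE a)
  have hb : 0 < μ.real (E b) := hδ.trans_le (hδE b)
  rw [Set.inter_inter_inter_comm, hAE]
  split_ifs with hab
  · subst hab
    calc (μ.real (E a))⁻¹ * (μ.real (E a))⁻¹ * (μ.real (A a ∩ A a) * μ.real (E a ∩ E a))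
        = (μ.real (E a))⁻¹ * μ.real (A a) := by
          rw [Set.inter_self, Set.inter_self]; field_simp
      _ ≤ δ⁻¹ * μ.real (A a) := by gcongr; exact hδE a
      _ ≤ δ⁻¹ * μ.real (A a) + μ.real (A a) := le_add_of_nonneg_right measureReal_nonneg
  · calc (μ.real (E a))⁻¹ * (μ.real (E b))⁻¹ * (μ.real (A a ∩ A b) * μ.real (E a ∩ E b))
        = μ.real (A a ∩ A b) := by rw [hEE hab]; field_simp
      _ ≤ 0 + μ.real (A a) := by
          rw [zero_add]
          exact measureReal_mono Set.inter_subset_left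

variable [Fintype κ]

theorem two_mul_sum_measureReal_sub_sum_sum_le {F : κ → Set Ω}
    (hF : ∀ a, MeasurableSet (F a)) (u : κ → ℝ) :
    2 * ∑ a, u a * μ.real (F a) - ∑ a, ∑ b, u a * u b * μ.real (F a ∩ F b) ≤
      μ.real (⋃ a, F a) := by
  have hint {S : Set Ω} (hS : MeasurableSet S) (r : ℝ) :
      Integrable (fun ω => r * S.indicator 1 ω) μ :=
    ((integrable_const 1).indicator hS).const_mul r
  have hintegral {S : Set Ω} (hS : MeasurableSet S) (r : ℝ) :
      ∫ ω, r * S.indicator 1 ω ∂μ = r * μ.real S := by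
    rw [integral_const_mul, integral_indicator_one hS]
  have hFF (a b : κ) : MeasurableSet (F a ∩ F b) := (hF a).inter (hF b)
  have hU : MeasurableSet (⋃ a, F a) := .iUnion hF
  have hlinear : Integrable (fun ω => 2 * ∑ a, u a * (F a).indicator 1 ω) μ :=
    (integrable_finsetSum _ fun a _ => hint (hF a) _).const_mul 2
  have hquadratic : Integrable (fun ω => ∑ a, ∑ b, u a * u b * (F a ∩ F b).indicator 1 ω) μ :=
    integrable_finsetSum _ fun a _ => integrable_finsetSum _ fun b _ => hint (hFF a b) _
  calc 2 * ∑ a, u a * μ.real (F a) - ∑ a, ∑ b, u a * u b * μ.real (F a ∩ F b)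
      = ∫ ω, (2 * ∑ a, u a * (F a).indicator 1 ω -
          ∑ a, ∑ b, u a * u b * (F a ∩ F b).indicator 1 ω) ∂μ := by
        rw [integral_sub hlinear hquadratic, integral_const_mul,
          integral_finsetSum _ fun a _ => hint (hF a) _,
          integral_finsetSum _ fun a _ => integrable_finsetSum _ fun b _ => hint (hFF a b) _]
        simp only [integral_finsetSum _ fun b _ => hint (hFF _ b) _, hintegral (hF _),
          hintegral (hFF _ _)]
    _ ≤ ∫ ω, (⋃ a, F a).indicator 1 ω ∂μ :=
        integral_mono (hlinear.sub hquadratic) ((integrable_const 1).indicator hU)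
          (two_mul_sum_indicator_sub_sum_sum_le F u)
    _ = μ.real (⋃ a, F a) := integral_indicator_one hU

theorem sq_sum_mul_measureReal_le {F : κ → Set Ω}
    (hF : ∀ a, MeasurableSet (F a)) (u : κ → ℝ) :
    (∑ a, u a * μ.real (F a)) ^ 2 ≤
      (∑ a, ∑ b, u a * u b * μ.real (F a ∩ F b)) * μ.real (⋃ a, F a) := by
  have hdiscrim := discrim_le_zero (a := ∑ a, ∑ b, u a * u b * μ.real (F a ∩ F b))
    (b := -2 * ∑ a, u a * μ.real (F a)) (c := μ.real (⋃ a, F a)) fun t => by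
      have hscaled := two_mul_sum_measureReal_sub_sum_sum_le hF (fun a => t * u a) (μ := μ)
      simp only [mul_mul_mul_comm t _ t, mul_assoc t, ← Finset.mul_sum] at hscaled
      linarith
  rw [discrim] at hdiscrim
  linarith

-- The second moment bound for the events `A a ∩ E a` with weights `1 / μ (E a)`.
theorem le_measureReal_iUnion_inter (hA : ∀ a, MeasurableSet (A a))
    (hE : ∀ a, MeasurableSet (E a))
    (hAE : ∀ a b, μ.real (A a ∩ A b ∩ (E a ∩ E b)) = μ.real (A a ∩ A b) * μ.real (E a ∩ E b))
    (hEE : Pairwise fun a b => μ.real (E a ∩ E b) = μ.real (E a) * μ.real (E b))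
    (hδ : 0 < δ) (hδE : ∀ a, δ ≤ μ.real (E a))
    (hsum : 1 + Fintype.card κ * δ ≤ ∑ a, μ.real (A a)) :
    δ ≤ μ.real (⋃ a, A a ∩ E a) := by
  classical
  set s : ℝ := ∑ a, μ.real (A a) with hs
  set m : ℝ := δ⁻¹ + Fintype.card κ with hm
  have hfirst : ∑ a, (μ.real (E a))⁻¹ * μ.real (A a ∩ E a) = s := by
    refine Finset.sum_congr rfl fun a _ => ?_
    have hpos : 0 < μ.real (E a) := hδ.trans_le (hδE a)
    have haa := hAE a a
    rw [Set.inter_self, Set.inter_self] at haa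
    rw [haa]
    field_simp
  have hsecond : ∑ a, ∑ b, (μ.real (E a))⁻¹ * (μ.real (E b))⁻¹ *
      μ.real (A a ∩ E a ∩ (A b ∩ E b)) ≤ m * s := by
    refine (Finset.sum_le_sum fun a _ => Finset.sum_le_sum fun b _ =>
      inv_mul_inv_mul_measureReal_inter_inter_le hδ hδE hAE hEE a b).trans_eq ?_
    simp only [Finset.sum_add_distrib, Finset.sum_ite_eq, Finset.mem_univ, if_true,
      Finset.sum_const, Finset.card_univ, nsmul_eq_mul, ← Finset.mul_sum, ← hs]
    ring
  have hmoment := sq_sum_mul_measureReal_le (fun a => (hA a).inter (hE a))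
    (fun a => (μ.real (E a))⁻¹) (μ := μ)
  rw [hfirst] at hmoment
  have hs_pos : 0 < s := (by positivity : (0 : ℝ) < 1 + Fintype.card κ * δ).trans_le hsum
  have hm_pos : 0 < m := by positivity
  have hms : s * s ≤ s * (m * μ.real (⋃ a, A a ∩ E a)) := by
    calc s * s ≤ m * s * μ.real (⋃ a, A a ∩ E a) := by rw [← sq]; exact hmoment.trans (by gcongr)
      _ = s * (m * μ.real (⋃ a, A a ∩ E a)) := by ring
  refine le_of_mul_le_mul_left ?_ hm_pos
  calc m * δ = 1 + Fintype.card κ * δ := by rw [hm]; field_simp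
    _ ≤ s := hsum
    _ ≤ m * μ.real (⋃ a, A a ∩ E a) := le_of_mul_le_mul_left hms hs_pos

end SecondMoment

section Coordinates

variable {ι : Type*} {X : ι → Type*} [∀ i, MeasurableSpace (X i)]
  {P : ∀ i, Measure (X i)} [∀ i, IsProbabilityMeasure (P i)]

theorem infinitePi_real_inter {S T : Set ι} (hST : Disjoint S T) {A B : Set (∀ i, X i)}
    (hA : MeasurableSet[cylinderEvents S] A) (hB : MeasurableSet[cylinderEvents T] B) :
    (Measure.infinitePi P).real (A ∩ B) =
      (Measure.infinitePi P).real A * (Measure.infinitePi P).real B := by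
  have hcoord : iIndep _ (Measure.infinitePi P) :=
    iIndepFun_infinitePi (P := P) (X := fun _ x => x) fun _ => measurable_id
  have hindep : Indep (cylinderEvents S) (cylinderEvents T) (Measure.infinitePi P) :=
    indep_iSup_of_disjoint (fun i => (measurable_pi_apply i).comap_le) hcoord hST
  rw [measureReal_def, (Indep_iff ..).1 hindep A B hA hB, ENNReal.toReal_mul]
  rfl

end Coordinates

/-! ### The renewal inequality -/

section PathRenewal

variable {V : Type*} {x : ℕ → V}

theorem setOf_followsPath (x : ℕ → V) (i k : ℕ) :
    {ω | FollowsPath ω x i k} =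
      (fun ω => ω (x i)) ⁻¹' ({y | ∀ l ≤ k, y l = x (i + l)} ×ˢ Set.Ici k) := by
  ext ω
  exact and_comm

theorem setOf_pathActivated_of_pos (x : ℕ → V) {n : ℕ} (hn : 0 < n) :
    {ω | PathActivated ω x n} =
      ⋃ i ∈ Set.Iio n, {ω | PathActivated ω x i} ∩ {ω | FollowsPath ω x i (n - i)} := by
  ext ω
  simp only [Set.mem_iUnion₂, Set.mem_inter_iff, Set.mem_ofPred_eq, Set.mem_Iio, exists_prop]
  refine ⟨fun h => ?_, fun ⟨i, hin, hi, hfollows⟩ => .step hin hi hfollows⟩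
  cases h with
  | zero => exact absurd hn (lt_irrefl 0)
  | step hin hi hfollows => exact ⟨_, hin, hi, hfollows⟩

/-- The event that the particle of `x i` reaches `x n` by following `x` and that no particle
between `x i` and `x n` does. -/
def lastFollowerEvent (x : ℕ → V) (n i : ℕ) : Set (V → (ℕ → V) × ℕ) :=
  {ω | FollowsPath ω x i (n - i)} ∩
    (⋃ j ∈ Finset.Ioo i n, {ω | FollowsPath ω x j (n - j)})ᶜ

theorem pairwiseDisjoint_lastFollowerEvent (x : ℕ → V) (n : ℕ) :
    (Set.Iio n).PairwiseDisjoint (lastFollowerEvent x n) := by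
  have hlt {i j : ℕ} (hij : i < j) (hj : j < n) :
      Disjoint (lastFollowerEvent x n i) (lastFollowerEvent x n j) :=
    Set.disjoint_left.2 fun _ hi hj' =>
      hi.2 (Set.mem_biUnion (Finset.mem_coe.2 (Finset.mem_Ioo.2 ⟨hij, hj⟩)) hj'.1)
  intro i hi j hj hij
  rcases hij.lt_or_gt with h | h
  · exact hlt h hj
  · exact (hlt h hi).symm

variable [MeasurableSpace V] [MeasurableSingletonClass V]

theorem measurableSet_followsPath {S : Set V} (x : ℕ → V) {i : ℕ} (hi : x i ∈ S) (k : ℕ) :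
    MeasurableSet[cylinderEvents S] {ω : V → (ℕ → V) × ℕ | FollowsPath ω x i k} := by
  rw [setOf_followsPath]
  exact measurable_cylinderEvent_apply hi
    ((measurableSet_forall_le_eq (fun l => x (i + l)) k).prod .of_discrete)

theorem measurableSet_pathActivated (x : ℕ → V) (n : ℕ) :
    MeasurableSet[cylinderEvents (x '' Set.Iio n)]
      {ω : V → (ℕ → V) × ℕ | PathActivated ω x n} := by
  induction n using Nat.strong_induction_on with
  | h n ih =>
    rcases n.eq_zero_or_pos with rfl | hn
    · simp only [PathActivated.zero, Set.ofPred_true, MeasurableSet.univ]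
    · rw [setOf_pathActivated_of_pos x hn]
      refine .biUnion (Set.finite_Iio n).countable fun i (hin : i < n) => .inter ?_ ?_
      · exact cylinderEvents_mono (Set.image_mono (Set.Iio_subset_Iio hin.le)) _ (ih i hin)
      · exact measurableSet_followsPath x (Set.mem_image_of_mem x (Set.mem_Iio.2 hin)) _

theorem measurableSet_iUnion_followsPath (x : ℕ → V) (i n : ℕ) :
    MeasurableSet[cylinderEvents (x '' Set.Ioo i n)]
      (⋃ j ∈ Finset.Ioo i n, {ω : V → (ℕ → V) × ℕ | FollowsPath ω x j (n - j)}) :=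
  Finset.measurableSet_biUnion _ fun _ hj =>
    measurableSet_followsPath x (Set.mem_image_of_mem x (Finset.mem_Ioo.1 hj)) _

theorem measurableSet_lastFollowerEvent (x : ℕ → V) (n i : ℕ) :
    MeasurableSet[cylinderEvents (x '' Set.Ici i)] (lastFollowerEvent x n i) :=
  .inter (measurableSet_followsPath x (Set.mem_image_of_mem x Set.self_mem_Ici) _)
    (cylinderEvents_mono (Set.image_mono fun _ hj => hj.1.le) _
      (measurableSet_iUnion_followsPath x i n).compl)

variable (P : V → Measure ((ℕ → V) × ℕ)) [∀ v, IsProbabilityMeasure (P v)]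

theorem le_infinitePi_real_lastFollowerEvent (hx : Function.Injective x) (n i : ℕ) :
    (Measure.infinitePi P).real {ω | FollowsPath ω x i (n - i)} *
        (1 - ∑ j ∈ Finset.Ioo i n,
          (Measure.infinitePi P).real {ω | FollowsPath ω x j (n - j)}) ≤
      (Measure.infinitePi P).real (lastFollowerEvent x n i) := by
  have hdisj : Disjoint {x i} (x '' Set.Ioo i n) := by
    rw [Set.disjoint_singleton_left, hx.mem_set_image]
    exact fun hi => lt_irrefl i hi.1
  have hlater := measurableSet_iUnion_followsPath x i n
  rw [lastFollowerEvent,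
    infinitePi_real_inter hdisj (measurableSet_followsPath x (Set.mem_singleton (x i)) _)
      hlater.compl,
    probReal_compl_eq_one_sub (cylinderEvents_le_pi _ hlater)]
  gcongr
  exact measureReal_biUnion_finset_le _ _

-- Decompose according to the last particle on the path that reaches `x n` by following it.
theorem sum_le_infinitePi_real_pathActivated (hx : Function.Injective x) (n : ℕ) :
    ∑ i ∈ Finset.range n, (Measure.infinitePi P).real {ω | PathActivated ω x i} *
        ((Measure.infinitePi P).real {ω | FollowsPath ω x i (n - i)} *
          (1 - ∑ j ∈ Finset.Ioo i n,
            (Measure.infinitePi P).real {ω | FollowsPath ω x j (n - j)})) ≤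
      (Measure.infinitePi P).real {ω | PathActivated ω x n} := by
  set μ := Measure.infinitePi P
  set A : ℕ → Set (V → (ℕ → V) × ℕ) := fun i => {ω | PathActivated ω x i}
  have hprod (i : ℕ) : μ.real (A i ∩ lastFollowerEvent x n i) =
      μ.real (A i) * μ.real (lastFollowerEvent x n i) :=
    infinitePi_real_inter ((Set.disjoint_image_iff hx).2 (Set.Iio_disjoint_Ici le_rfl))
      (measurableSet_pathActivated x i) (measurableSet_lastFollowerEvent x n i)
  have hdisj : (Finset.range n : Set ℕ).PairwiseDisjoint
      fun i => A i ∩ lastFollowerEvent x n i := by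
    rw [Finset.coe_range]
    exact (pairwiseDisjoint_lastFollowerEvent x n).mono fun i => Set.inter_subset_right
  have hmeas (i : ℕ) : MeasurableSet (A i ∩ lastFollowerEvent x n i) :=
    .inter (cylinderEvents_le_pi _ (measurableSet_pathActivated x i))
      (cylinderEvents_le_pi _ (measurableSet_lastFollowerEvent x n i))
  calc ∑ i ∈ Finset.range n, μ.real (A i) * (μ.real {ω | FollowsPath ω x i (n - i)} *
          (1 - ∑ j ∈ Finset.Ioo i n, μ.real {ω | FollowsPath ω x j (n - j)}))
      ≤ ∑ i ∈ Finset.range n, μ.real (A i ∩ lastFollowerEvent x n i) := by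
        refine Finset.sum_le_sum fun i _ => ?_
        rw [hprod]
        gcongr
        exact le_infinitePi_real_lastFollowerEvent P hx n i
    _ = μ.real (⋃ i ∈ Finset.range n, A i ∩ lastFollowerEvent x n i) :=
        (measureReal_biUnion_finset hdisj fun i _ => hmeas i).symm
    _ ≤ μ.real (A n) := measureReal_mono <| Set.iUnion₂_subset fun i hi ω hω =>
        PathActivated.step (Finset.mem_range.1 hi) hω.1 hω.2.1

end PathRenewal

section RenewalSequence

/-- Supersolutions of the renewal equation `a (n + 1) = ∑ m ≤ n, h m * a (n - m)`, `a 0 = 1`. -/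
def IsRenewalSupersolution (h a : ℕ → ℝ) : Prop :=
  1 ≤ a 0 ∧ ∀ n, ∑ m ∈ Finset.range (n + 1), h m * a (n - m) ≤ a (n + 1)

variable {h a : ℕ → ℝ}

theorem IsRenewalSupersolution.nonneg (ha : IsRenewalSupersolution h a) (hh : ∀ m, 0 ≤ h m)
    (n : ℕ) : 0 ≤ a n := by
  induction n using Nat.strong_induction_on with
  | h n ih =>
    cases n with
    | zero => exact zero_le_one.trans ha.1
    | succ n =>
      refine le_trans (Finset.sum_nonneg fun m _ => ?_) (ha.2 n)
      exact mul_nonneg (hh m) (ih _ (by omega))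

theorem IsRenewalSupersolution.pow_le (ha : IsRenewalSupersolution h a) (hh : ∀ m, 0 ≤ h m)
    (n : ℕ) : h 0 ^ n ≤ a n := by
  induction n with
  | zero => simpa only [pow_zero] using ha.1
  | succ n ih =>
    calc h 0 ^ (n + 1) = h 0 * h 0 ^ n := pow_succ' _ _
      _ ≤ h 0 * a (n - 0) := mul_le_mul_of_nonneg_left ih (hh 0)
      _ ≤ ∑ m ∈ Finset.range (n + 1), h m * a (n - m) :=
          Finset.single_le_sum (f := fun m => h m * a (n - m))
            (fun m _ => mul_nonneg (hh m) (ha.nonneg hh _)) (Finset.mem_range.2 n.succ_pos)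
      _ ≤ a (n + 1) := ha.2 n

theorem IsRenewalSupersolution.mul_pow_le (ha : IsRenewalSupersolution h a) (hh : ∀ m, 0 ≤ h m)
    {C r : ℝ} (hC : 0 ≤ C) (hr : 0 < r) {N : ℕ}
    (hsum : 1 ≤ ∑ m ∈ Finset.range N, h m / r ^ (m + 1)) (hinit : ∀ n < N, C * r ^ n ≤ a n)
    (n : ℕ) : C * r ^ n ≤ a n := by
  induction n using Nat.strong_induction_on with
  | h n ih =>
    rcases lt_or_ge n N with hn | hn
    · exact hinit n hn
    obtain _ | k := n
    · obtain rfl : N = 0 := by omega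
      norm_num at hsum
    calc C * r ^ (k + 1) ≤ C * r ^ (k + 1) * ∑ m ∈ Finset.range N, h m / r ^ (m + 1) :=
          le_mul_of_one_le_right (by positivity) hsum
      _ = ∑ m ∈ Finset.range N, h m * (C * r ^ (k - m)) := by
          rw [Finset.mul_sum]
          refine Finset.sum_congr rfl fun m hm => ?_
          have hpow : r ^ (k + 1) = r ^ (k - m) * r ^ (m + 1) := by
            rw [← pow_add]
            congr 1
            have := Finset.mem_range.1 hm
            omega
          rw [hpow]
          field_simp
      _ ≤ ∑ m ∈ Finset.range N, h m * a (k - m) :=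
          Finset.sum_le_sum fun m _ => mul_le_mul_of_nonneg_left (ih _ (by omega)) (hh m)
      _ ≤ ∑ m ∈ Finset.range (k + 1), h m * a (k - m) :=
          Finset.sum_le_sum_of_subset_of_nonneg (Finset.range_mono hn)
            fun m _ _ => mul_nonneg (hh m) (ha.nonneg hh _)
      _ ≤ a (k + 1) := ha.2 k

theorem exists_one_lt_one_le_sum_div_pow {N : ℕ} (hsum : 1 < ∑ m ∈ Finset.range N, h m) :
    ∃ r : ℝ, 1 < r ∧ 1 ≤ ∑ m ∈ Finset.range N, h m / r ^ (m + 1) := by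
  have hcont : ContinuousAt (fun r : ℝ => ∑ m ∈ Finset.range N, h m / r ^ (m + 1)) 1 := by
    fun_prop (disch := norm_num)
  have hlt : ∀ᶠ r in nhdsWithin (1 : ℝ) (Set.Ioi 1),
      1 < ∑ m ∈ Finset.range N, h m / r ^ (m + 1) :=
    nhdsWithin_le_nhds (hcont.eventually (lt_mem_nhds (by simpa using hsum)))
  obtain ⟨r, hr_sum, hr⟩ := (hlt.and self_mem_nhdsWithin).exists
  exact ⟨r, hr, hr_sum.le⟩

theorem exists_forall_isRenewalSupersolution_two_le (hh : ∀ m, 0 ≤ h m) (h0 : 0 < h 0) {N : ℕ}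
    (hsum : 1 < ∑ m ∈ Finset.range N, h m) :
    ∃ n, ∀ a, IsRenewalSupersolution h a → 2 ≤ a (n + 1) := by
  obtain ⟨r, hr, hr_sum⟩ := exists_one_lt_one_le_sum_div_pow hsum
  have hr_pos : 0 < r := zero_lt_one.trans hr
  set ρ : ℝ := min 1 (h 0 / r)
  have hρ : 0 < ρ := lt_min one_pos (div_pos h0 hr_pos)
  have hinit (n : ℕ) (hn : n < N) : ρ ^ N * r ^ n ≤ h 0 ^ n := by
    calc ρ ^ N * r ^ n ≤ ρ ^ n * r ^ n := by
          have := pow_le_pow_of_le_one hρ.le (min_le_left _ _) hn.le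
          gcongr
      _ = (ρ * r) ^ n := (mul_pow _ _ _).symm
      _ ≤ h 0 ^ n := by
          gcongr
          exact (le_div_iff₀ hr_pos).1 (min_le_right _ _)
  obtain ⟨n, hn⟩ := pow_unbounded_of_one_lt (2 / ρ ^ N) hr
  refine ⟨n, fun a ha => ?_⟩
  calc (2 : ℝ) ≤ ρ ^ N * r ^ n := ((div_lt_iff₀' (by positivity)).1 hn).le
    _ ≤ ρ ^ N * r ^ (n + 1) := by
        gcongr
        · exact hr.le
        · exact n.le_succ
    _ ≤ a (n + 1) := ha.mul_pow_le hh (by positivity) hr_pos hr_sum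
        (fun n hn => (hinit n hn).trans (ha.pow_le hh n)) _

/-- The weights of the renewal inequality for the expected numbers of activated descendants. A
particle makes its first `m + 1` jumps along a given path with probability `c * s ^ (m + 1)`, where
`s = p / d`. The factor `p ^ (m + 1)` is `s ^ (m + 1)` times the number of descendants, and the sum
bounds the probability that a later particle on the path reaches the same vertex. -/
noncomputable def lastFollowerWeight (c p s : ℝ) (m : ℕ) : ℝ :=
  c * p ^ (m + 1) * (1 - ∑ j ∈ Finset.range m, c * s ^ (j + 1))

variable {c p s : ℝ}

theorem lastFollowerWeight_zero (c p s : ℝ) : lastFollowerWeight c p s 0 = c * p := by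
  simp [lastFollowerWeight]

theorem lastFollowerWeight_nonneg (hc0 : 0 ≤ c) (hc1 : c ≤ 1) (hp : 0 ≤ p) (hs0 : 0 ≤ s)
    (hs : s ≤ 1 / 2) (m : ℕ) : 0 ≤ lastFollowerWeight c p s m := by
  refine mul_nonneg (by positivity) (sub_nonneg.2 ?_)
  have hgeom := mul_neg_geom_sum s m
  have : 0 ≤ ∑ j ∈ Finset.range m, s ^ j := Finset.sum_nonneg fun j _ => by positivity
  calc ∑ j ∈ Finset.range m, c * s ^ (j + 1)
      ≤ ∑ j ∈ Finset.range m, s ^ (j + 1) :=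
        Finset.sum_le_sum fun j _ => mul_le_of_le_one_left (by positivity) hc1
    _ = s * ∑ j ∈ Finset.range m, s ^ j := by simp only [Finset.mul_sum, pow_succ']
    _ ≤ (1 - s) * ∑ j ∈ Finset.range m, s ^ j := by gcongr; linarith
    _ ≤ 1 := by rw [hgeom]; linarith [pow_nonneg hs0 m]

theorem hasSum_lastFollowerWeight (c : ℝ) (hp0 : 0 ≤ p) (hp1 : p < 1) (hs0 : 0 ≤ s)
    (hs1 : s < 1) :
    HasSum (lastFollowerWeight c p s)
      (c * p / (1 - p) - c ^ 2 * p ^ 2 * s / ((1 - p) * (1 - s * p))) := by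
  have hsp : s * p < 1 := mul_lt_one_of_nonneg_of_lt_one_left hs0 hs1 hp1.le
  have hterm (m : ℕ) : lastFollowerWeight c p s m =
      (c * p - c ^ 2 * p * s / (1 - s)) * p ^ m + c ^ 2 * p * s / (1 - s) * (s * p) ^ m := by
    have hgeom : ∑ j ∈ Finset.range m, c * s ^ (j + 1) = c * s * ((1 - s ^ m) / (1 - s)) := by
      rw [← mul_neg_geom_sum, mul_div_cancel_left₀ _ (sub_pos.2 hs1).ne', Finset.mul_sum]
      exact Finset.sum_congr rfl fun j _ => by ring
    rw [lastFollowerWeight, hgeom]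
    ring
  have hsum := ((hasSum_geometric_of_lt_one hp0 hp1).mul_left
      (c * p - c ^ 2 * p * s / (1 - s))).add
    ((hasSum_geometric_of_lt_one (mul_nonneg hs0 hp0) hsp).mul_left (c ^ 2 * p * s / (1 - s)))
  have hvalue : c * p / (1 - p) - c ^ 2 * p ^ 2 * s / ((1 - p) * (1 - s * p)) =
      (c * p - c ^ 2 * p * s / (1 - s)) * (1 - p)⁻¹ +
        c ^ 2 * p * s / (1 - s) * (1 - s * p)⁻¹ := by
    have hp' : 1 - p ≠ 0 := (sub_pos.2 hp1).ne'
    have hs' : 1 - s ≠ 0 := (sub_pos.2 hs1).ne'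
    have hsp' : 1 - s * p ≠ 0 := (sub_pos.2 hsp).ne'
    have hps' : 1 - p * s ≠ 0 := mul_comm s p ▸ hsp'
    field_simp
    ring
  rw [funext hterm, hvalue]
  exact hsum

theorem exists_one_lt_sum_lastFollowerWeight (hp0 : 0 ≤ p) (hp1 : p < 1) (hs0 : 0 ≤ s)
    (hs1 : s < 1) (hcrit : c ^ 2 * p ^ 2 * s < ((1 + c) * p - 1) * (1 - s * p)) :
    ∃ N, 1 < ∑ m ∈ Finset.range N, lastFollowerWeight c p s m := by
  have : 0 < 1 - p := sub_pos.2 hp1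
  have hsp' : 0 < 1 - s * p := sub_pos.2 (mul_lt_one_of_nonneg_of_lt_one_left hs0 hs1 hp1.le)
  have hlimit : 1 < c * p / (1 - p) - c ^ 2 * p ^ 2 * s / ((1 - p) * (1 - s * p)) := by
    rw [← mul_div_mul_right (c * p) (1 - p) hsp'.ne', ← sub_div, lt_div_iff₀ (by positivity)]
    linarith
  exact (((hasSum_lastFollowerWeight c hp0 hp1 hs0 hs1).tendsto_sum_nat.eventually
    (lt_mem_nhds hlimit))).exists

end RenewalSequence

section SafLaw

variable {d : ℕ} {p : unitInterval}

instance safLaw.instIsProbabilityMeasure {V : Type*} [MeasurableSpace V]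
    [DiscreteMeasurableSpace V] [Countable V] (G : SimpleGraph V) (p : unitInterval) :
    IsProbabilityMeasure (safLaw G p) := by
  unfold safLaw
  infer_instance

theorem safLaw_homTree_real_followsPath (hp : p < 1) (v : TreeVertex d) (f : ℕ → Fin d)
    (i k : ℕ) :
    (safLaw (homTree d) p).real {ω | FollowsPath ω (descPath v f) i (k + 1)} =
      (d / (d + 1) : ℝ) * (p / d) ^ (k + 1) := by
  have hd : (d : ℝ) ≠ 0 := Nat.cast_ne_zero.2 (f 0).pos.ne'
  have hmeas := (measurableSet_forall_le_eq
    (fun l => descPath v f (i + l)) (k + 1)).prod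
    (MeasurableSet.of_discrete (s := Set.Ici (k + 1)))
  have hsymm : unitInterval.symm p ≠ 0 := by
    rwa [ne_eq, unitInterval.symm_eq_zero, ← ne_eq, ne_iff_lt_iff_le.2 unitInterval.le_one']
  rw [setOf_followsPath, safLaw,
    ← map_measureReal_apply (measurable_pi_apply (descPath v f i)) hmeas,
    Measure.infinitePi_map_eval, measureReal_prod_prod, geometricMeasure_real_Ici hsymm]
  simp only [descPath_add v f i]
  rw [sawLaw_homTree_real_descPath, unitInterval.coe_symm_eq, sub_sub_cancel, div_pow,
    pow_succ (d : ℝ) k]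
  field_simp

theorem isRenewalSupersolution_safLaw_real_pathActivated (hp : p < 1) (v : TreeVertex d)
    (f : ℕ → Fin d) :
    IsRenewalSupersolution (lastFollowerWeight (d / (d + 1)) p (p / d))
      fun n => d ^ n * (safLaw (homTree d) p).real {ω | PathActivated ω (descPath v f) n} := by
  have hd : (d : ℝ) ≠ 0 := Nat.cast_ne_zero.2 (f 0).pos.ne'
  refine ⟨by simp [PathActivated.zero], fun n => ?_⟩
  have hlater (m : ℕ) (hm : m ≤ n) : ∑ j ∈ Finset.Ioo (n - m) (n + 1),
      (safLaw (homTree d) p).real {ω | FollowsPath ω (descPath v f) j (n + 1 - j)} =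
        ∑ j ∈ Finset.range m, (d / (d + 1) : ℝ) * (p / d) ^ (j + 1) := by
    refine Finset.sum_nbij' (fun j => n - j) (fun j => n - j) ?_ ?_ ?_ ?_ fun j hj => ?_
    any_goals intro j hj; simp only [Finset.mem_Ioo, Finset.mem_range] at hj ⊢; omega
    obtain ⟨k, rfl⟩ := Nat.exists_eq_add_of_le (Nat.lt_succ_iff.1 (Finset.mem_Ioo.1 hj).2)
    rw [add_assoc, Nat.add_sub_cancel_left, Nat.add_sub_cancel_left,
      safLaw_homTree_real_followsPath hp]
  have hrenewal := sum_le_infinitePi_real_pathActivated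
    (fun v => (sawLaw (homTree d) v).prod (geometricMeasure (unitInterval.symm p)))
    (descPath_injective v f) (n + 1)
  rw [← safLaw, ← Finset.sum_range_reflect] at hrenewal
  refine le_trans (le_of_eq ?_)
    (mul_le_mul_of_nonneg_left hrenewal (by positivity : (0 : ℝ) ≤ d ^ (n + 1)))
  rw [Finset.mul_sum]
  refine Finset.sum_congr rfl fun m hm => ?_
  have hmn : m ≤ n := Nat.lt_succ_iff.1 (Finset.mem_range.1 hm)
  have hpow : (d : ℝ) ^ (n + 1) = d ^ (n - m) * d ^ (m + 1) := by
    rw [← pow_add, ← add_assoc, Nat.sub_add_cancel hmn]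
  simp only [Nat.add_sub_cancel]
  rw [hlater m hmn, show n + 1 - (n - m) = m + 1 by omega,
    safLaw_homTree_real_followsPath hp, lastFollowerWeight, hpow, div_pow]
  field_simp

end SafLaw

/-! ### Survival -/

section Survival

variable {d : ℕ}

theorem image_descPath_Iio_subset (v : TreeVertex d) (f : ℕ → Fin d) (n : ℕ) :
    descPath v f '' Set.Iio n ⊆
      {w | v.word <:+ w.word ∧ w.word.length < v.word.length + n} := by
  rintro _ ⟨i, hi : i < n, rfl⟩
  refine ⟨word_suffix_word_descPath v f i, ?_⟩
  rw [length_word_descPath]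
  exact Nat.add_lt_add_left hi _

variable [NeZero d]

/-- The infinite sequence of labels that extends `f` by `0`. -/
def extendLabels {n : ℕ} (f : Fin n → Fin d) (j : ℕ) : Fin d :=
  if h : j < n then f ⟨j, h⟩ else 0

theorem descPath_extendLabels_injective (v : TreeVertex d) (n : ℕ) :
    Function.Injective fun f : Fin n → Fin d => descPath v (extendLabels f) n := by
  intro f g h
  funext j
  simpa only [extendLabels, j.2, dif_pos] using eq_of_descPath_eq v h j j.2

/-- The event that there are vertices `v = v₀, v₁, …, vₖ`, each of them a descendant of the previous
one, `n` levels below it, that is `PathActivated` along the path that joins them. -/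
def generationEvent (n : ℕ) : ℕ → TreeVertex d → Set (TreeVertex d → (ℕ → TreeVertex d) × ℕ)
  | 0, _ => Set.univ
  | k + 1, v => ⋃ f : Fin n → Fin d, {ω | PathActivated ω (descPath v (extendLabels f)) n} ∩
      generationEvent n k (descPath v (extendLabels f) n)

theorem measurableSet_generationEvent (n k : ℕ) (v : TreeVertex d) :
    MeasurableSet[cylinderEvents {w | v.word <:+ w.word}] (generationEvent n k v) := by
  induction k generalizing v with
  | zero => exact .univ
  | succ k ih =>
    refine .iUnion fun f => .inter ?_ ?_
    · exact cylinderEvents_mono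
        (fun w hw => (image_descPath_Iio_subset v (extendLabels f) n hw).1) _
        (measurableSet_pathActivated _ n)
    · exact cylinderEvents_mono
        (fun w hw => (word_suffix_word_descPath v (extendLabels f) n).trans hw) _ (ih _)

theorem antitone_generationEvent (n : ℕ) (v : TreeVertex d) :
    Antitone fun k => generationEvent n k v := by
  refine antitone_nat_of_succ_le fun k => ?_
  induction k generalizing v with
  | zero => exact Set.subset_univ _
  | succ k ih => exact Set.iUnion_mono fun f => Set.inter_subset_inter_right _ (ih _)

theorem exists_activated_of_mem_generationEvent {n k : ℕ} {o v : TreeVertex d}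
    {ω : TreeVertex d → (ℕ → TreeVertex d) × ℕ} (hω : ω ∈ generationEvent n k v)
    (hv : Activated o ω v) :
    ∃ w : TreeVertex d, Activated o ω w ∧ w.word.length = v.word.length + k * n := by
  induction k generalizing v with
  | zero => exact ⟨v, hv, by rw [zero_mul, add_zero]⟩
  | succ k ih =>
    obtain ⟨f, hf, hk⟩ := Set.mem_iUnion.1 hω
    obtain ⟨w, hw, hlength⟩ := ih hk (PathActivated.activated hf hv)
    refine ⟨w, hw, ?_⟩
    rw [hlength, length_word_descPath]
    ring

theorem iInter_generationEvent_subset_setOf_frogSurvives {n : ℕ} (hn : 0 < n) (o : TreeVertex d) :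
    ⋂ k, generationEvent n k o ⊆ {ω | FrogSurvives o ω} := by
  intro ω hω
  refine frogSurvives_of_infinite fun hfin => ?_
  obtain ⟨b, hb⟩ := (hfin.image fun w => w.word.length).bddAbove
  obtain ⟨w, hw, hlength⟩ := exists_activated_of_mem_generationEvent
    (Set.mem_iInter.1 hω (b + 1)) (activated_origin o ω)
  have hle : w.word.length ≤ b := hb ⟨w, hw, rfl⟩
  have : b + 1 ≤ (b + 1) * n := Nat.le_mul_of_pos_right _ hn
  omega

variable {p : unitInterval} {n : ℕ}

theorem safLaw_real_pathActivated_inter_generationEvent (v : TreeVertex d)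
    (f g : Fin n → Fin d) (k : ℕ) :
    (safLaw (homTree d) p).real
        ({ω | PathActivated ω (descPath v (extendLabels f)) n} ∩
            {ω | PathActivated ω (descPath v (extendLabels g)) n} ∩
          (generationEvent n k (descPath v (extendLabels f) n) ∩
            generationEvent n k (descPath v (extendLabels g) n))) =
      (safLaw (homTree d) p).real
          ({ω | PathActivated ω (descPath v (extendLabels f)) n} ∩
            {ω | PathActivated ω (descPath v (extendLabels g)) n}) *
        (safLaw (homTree d) p).real
          (generationEvent n k (descPath v (extendLabels f) n) ∩
            generationEvent n k (descPath v (extendLabels g) n)) := by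
  have hA (f : Fin n → Fin d) :
      MeasurableSet[cylinderEvents {w : TreeVertex d | w.word.length < v.word.length + n}]
        {ω : TreeVertex d → (ℕ → TreeVertex d) × ℕ |
          PathActivated ω (descPath v (extendLabels f)) n} :=
    cylinderEvents_mono (fun w hw => (image_descPath_Iio_subset v (extendLabels f) n hw).2) _
      (measurableSet_pathActivated _ n)
  have hE (f : Fin n → Fin d) :
      MeasurableSet[cylinderEvents {w : TreeVertex d | v.word.length + n ≤ w.word.length}]
        (generationEvent n k (descPath v (extendLabels f) n)) :=
    cylinderEvents_mono (fun w hw => (length_word_descPath v _ n).ge.trans hw.length_le) _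
      (measurableSet_generationEvent n k _)
  exact infinitePi_real_inter (Set.disjoint_left.2 fun w hw hw' => Nat.not_lt.2 hw' hw)
    ((hA f).inter (hA g)) ((hE f).inter (hE g))

theorem safLaw_real_generationEvent_inter {v w : TreeVertex d} (hne : v ≠ w)
    (hlength : v.word.length = w.word.length) (k : ℕ) :
    (safLaw (homTree d) p).real (generationEvent n k v ∩ generationEvent n k w) =
      (safLaw (homTree d) p).real (generationEvent n k v) *
        (safLaw (homTree d) p).real (generationEvent n k w) := by
  refine infinitePi_real_inter (Set.disjoint_left.2 fun u hv hw => hne (TreeVertex.ext ?_))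
    (measurableSet_generationEvent n k v) (measurableSet_generationEvent n k w)
  exact (List.suffix_of_suffix_length_le hv hw hlength.le).eq_of_length hlength

theorem inv_le_safLaw_real_generationEvent
    (h : ∀ (v : TreeVertex d) (f : ℕ → Fin d),
      2 ≤ (d : ℝ) ^ n * (safLaw (homTree d) p).real {ω | PathActivated ω (descPath v f) n})
    (k : ℕ) (v : TreeVertex d) :
    ((d : ℝ) ^ n)⁻¹ ≤ (safLaw (homTree d) p).real (generationEvent n k v) := by
  have hd : (1 : ℝ) ≤ d := by exact_mod_cast NeZero.one_le
  have hcard : (Fintype.card (Fin n → Fin d) : ℝ) = d ^ n := by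
    rw [Fintype.card_fun, Fintype.card_fin, Fintype.card_fin, Nat.cast_pow]
  induction k generalizing v with
  | zero =>
    rw [generationEvent, probReal_univ]
    exact inv_le_one_of_one_le₀ (one_le_pow₀ hd)
  | succ k ih =>
    refine le_measureReal_iUnion_inter
      (fun f => cylinderEvents_le_pi _ (measurableSet_pathActivated _ n))
      (fun f => cylinderEvents_le_pi _ (measurableSet_generationEvent n k _))
      (fun f g => safLaw_real_pathActivated_inter_generationEvent v f g k)
      (fun f g hfg => safLaw_real_generationEvent_inter
        ((descPath_extendLabels_injective v n).ne hfg) ?_ k)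
      (by positivity) (fun f => ih _) ?_
    · simp only [length_word_descPath]
    · calc 1 + Fintype.card (Fin n → Fin d) * ((d : ℝ) ^ n)⁻¹
          = ∑ _f : Fin n → Fin d, 2 / (d : ℝ) ^ n := by
            rw [Finset.sum_const, Finset.card_univ, nsmul_eq_mul, hcard]
            field_simp
            norm_num
        _ ≤ _ := Finset.sum_le_sum fun f _ => (div_le_iff₀' (by positivity)).2 (h v _)

theorem safSurvivalProb_pos (hn : 0 < n)
    (h : ∀ (v : TreeVertex d) (f : ℕ → Fin d),
      2 ≤ (d : ℝ) ^ n * (safLaw (homTree d) p).real {ω | PathActivated ω (descPath v f) n})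
    (o : TreeVertex d) : 0 < safSurvivalProb (homTree d) o p := by
  have hd : (0 : ℝ) < d := by exact_mod_cast Nat.pos_of_neZero d
  set μ := safLaw (homTree d) p
  have hlim : Filter.Tendsto (fun k => μ.real (generationEvent n k o)) Filter.atTop
      (nhds (μ.real (⋂ k, generationEvent n k o))) :=
    (ENNReal.tendsto_toReal (measure_ne_top _ _)).comp
      (tendsto_measure_iInter_atTop
        (fun k => (cylinderEvents_le_pi _
          (measurableSet_generationEvent n k o)).nullMeasurableSet)
        (antitone_generationEvent n o) ⟨0, measure_ne_top _ _⟩)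
  calc 0 < ((d : ℝ) ^ n)⁻¹ := by positivity
    _ ≤ μ.real (⋂ k, generationEvent n k o) :=
        ge_of_tendsto' hlim fun k => inv_le_safLaw_real_generationEvent h k o
    _ ≤ safSurvivalProb (homTree d) o p :=
        measureReal_mono (iInter_generationEvent_subset_setOf_frogSurvives hn o)

end Survival

section Criterion

variable {d : ℕ} {p : ℝ}

theorem mem_safSurvivalSet (hd : 2 ≤ d) (hp0 : 0 < p) (hp1 : p < 1)
    (hcrit : (d : ℝ) ^ 2 * p ^ 3 < (d + 1) * ((2 * d + 1) * p - (d + 1)) * (d - p ^ 2)) :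
    p ∈ safSurvivalSet d := by
  have : NeZero d := ⟨by omega⟩
  have hd2 : (2 : ℝ) ≤ d := by exact_mod_cast hd
  have hs : p / d ≤ 1 / 2 := by
    rw [div_le_div_iff₀ (by linarith) two_pos]
    linarith
  have hcrit' : ((d : ℝ) / (d + 1)) ^ 2 * p ^ 2 * (p / d) <
      ((1 + d / (d + 1)) * p - 1) * (1 - p / d * p) := by
    have hright : ((1 + (d : ℝ) / (d + 1)) * p - 1) * (1 - p / d * p) =
        (d + 1) * ((2 * d + 1) * p - (d + 1)) * (d - p ^ 2) / ((d + 1) ^ 2 * d) := by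
      field_simp
      ring
    have hleft : ((d : ℝ) / (d + 1)) ^ 2 * p ^ 2 * (p / d) =
        d ^ 2 * p ^ 3 / ((d + 1) ^ 2 * d) := by
      field_simp
    rw [hleft, hright]
    gcongr
  obtain ⟨N, hN⟩ := exists_one_lt_sum_lastFollowerWeight hp0.le hp1 (by positivity)
    (by linarith) hcrit'
  obtain ⟨n, hn⟩ := exists_forall_isRenewalSupersolution_two_le
    (lastFollowerWeight_nonneg (by positivity) (div_le_one_of_le₀ (by linarith) (by positivity))
      hp0.le (by positivity) hs)
    (by rw [lastFollowerWeight_zero]; positivity) hN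
  set q : unitInterval := ⟨p, hp0.le, hp1.le⟩
  exact ⟨q, rfl, hp0, hp1, safSurvivalProb_pos n.succ_pos (fun v f => hn _
    (isRenewalSupersolution_safLaw_real_pathActivated (p := q) hp1 v f)) _⟩

theorem safCriticalParam_le (hp : p ∈ safSurvivalSet d) : safCriticalParam d ≤ p := by
  refine csInf_le ⟨0, ?_⟩ hp
  rintro _ ⟨q, rfl, -⟩
  exact q.2.1

end Criterion

/-! ### The smaller root -/

section QuadraticRoot

variable {a b c x : ℝ}

theorem discrim_pos_of_quadratic_neg (ha : 0 < a) (hx : a * (x * x) + b * x + c < 0) :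
    0 < discrim a b c := by
  have := mul_pos_of_neg_of_neg hx (neg_neg_of_pos ha)
  rw [discrim]
  linarith [sq_nonneg (2 * a * x + b)]

theorem neg_sub_sqrt_discrim_div_lt (ha : 0 < a) (hx : a * (x * x) + b * x + c < 0) :
    (-b - √(discrim a b c)) / (2 * a) < x := by
  have hsq : (-b - 2 * a * x) ^ 2 < discrim a b c := by
    have := mul_pos_of_neg_of_neg hx (neg_neg_of_pos ha)
    rw [discrim]
    linarith
  rw [div_lt_iff₀ (by positivity)]
  linarith [Real.lt_sqrt_of_sq_lt hsq]

theorem quadratic_neg_sub_sqrt_discrim_div (ha : a ≠ 0) (h : 0 ≤ discrim a b c) :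
    a * ((-b - √(discrim a b c)) / (2 * a) * ((-b - √(discrim a b c)) / (2 * a))) +
      b * ((-b - √(discrim a b c)) / (2 * a)) + c = 0 :=
  (quadratic_eq_zero_iff ha (Real.mul_self_sqrt h).symm _).2 (.inr rfl)

theorem neg_sub_sqrt_discrim_div_pos (ha : 0 < a) (hb : b < 0) (hc : 0 < c) :
    0 < (-b - √(discrim a b c)) / (2 * a) := by
  have : 0 < 4 * a * c := by positivity
  refine div_pos (sub_pos.2 ((Real.sqrt_lt' (neg_pos.2 hb)).2 ?_)) (by positivity)
  rw [discrim]
  linarith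

end QuadraticRoot

section Bounds

variable {d x : ℝ}

/-- A quadratic polynomial whose smaller root is `newBound d`. It vanishes at `p` iff
`(1 + c) * p - 1 = 8 / 7 * (c / (1 + c)) ^ 2 * s * (1 + s)`, where `c = d / (d + 1)` and
`s = p / d`; this is the equality case of the survival criterion with `((1 + c) * p) ^ 2 /
(1 - s * p)` replaced by its upper bound `8 / 7 * (1 + s)`. -/
def newBoundPoly (d x : ℝ) : ℝ :=
  8 * (d + 1) * (x * x) + (8 * d * (d + 1) - 7 * (2 * d + 1) ^ 3) * x +
    7 * (d + 1) * (2 * d + 1) ^ 2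

theorem newBound_eq (hd : 0 < d) :
    newBound d = (-(8 * d * (d + 1) - 7 * (2 * d + 1) ^ 3) -
      √(discrim (8 * (d + 1)) (8 * d * (d + 1) - 7 * (2 * d + 1) ^ 3)
        (7 * (d + 1) * (2 * d + 1) ^ 2))) / (2 * (8 * (d + 1))) := by
  have hF : boundF (d / (d + 1)) d =
      d / (d + 1) ^ 3 * (7 * (2 * d + 1) ^ 3 - 8 * d * (d + 1)) := by
    rw [boundF]
    field_simp
    ring
  have hD : boundF (d / (d + 1)) d ^ 2 - 224 * (d / (d + 1)) ^ 2 * (d / (d + 1) + 1) ^ 2 =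
      (d / (d + 1) ^ 3) ^ 2 * discrim (8 * (d + 1)) (8 * d * (d + 1) - 7 * (2 * d + 1) ^ 3)
        (7 * (d + 1) * (2 * d + 1) ^ 2) := by
    rw [hF, discrim]
    field_simp
    ring
  rw [newBound]
  rw [hD, hF, Real.sqrt_mul (sq_nonneg _), Real.sqrt_sq (by positivity)]
  field_simp
  ring

theorem newBound_lt_of_newBoundPoly_neg (hd : 0 < d) (hx : newBoundPoly d x < 0) :
    newBound d < x := by
  rw [newBound_eq hd]
  exact neg_sub_sqrt_discrim_div_lt (by positivity) hx

theorem newBoundPoly_two_thirds_neg (hd : 2 ≤ d) : newBoundPoly d (2 / 3) < 0 := by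
  rw [newBoundPoly]
  nlinarith [mul_nonneg (sub_nonneg.2 hd) (sq_nonneg d)]

theorem newBound_lt_two_thirds (hd : 2 ≤ d) : newBound d < 2 / 3 :=
  newBound_lt_of_newBoundPoly_neg (by linarith) (newBoundPoly_two_thirds_neg hd)

theorem newBoundPoly_newBound (hd : 2 ≤ d) : newBoundPoly d (newBound d) = 0 := by
  have ha : 0 < 8 * (d + 1) := by linarith
  rw [newBound_eq (by linarith)]
  exact quadratic_neg_sub_sqrt_discrim_div ha.ne'
    (discrim_pos_of_quadratic_neg ha (newBoundPoly_two_thirds_neg hd)).le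

theorem newBound_pos (hd : 0 < d) : 0 < newBound d := by
  rw [newBound_eq hd]
  refine neg_sub_sqrt_discrim_div_pos (by positivity) ?_ (by positivity)
  have : 0 < d ^ 3 := by positivity
  nlinarith

theorem mul_newBound_sub_eq (hd : 2 ≤ d) :
    7 * (2 * d + 1) ^ 2 * ((2 * d + 1) * newBound d - (d + 1)) =
      8 * (d + 1) * newBound d * (d + newBound d) := by
  have h := newBoundPoly_newBound hd
  rw [newBoundPoly] at h
  linear_combination -h

theorem half_lt_newBound (hd : 2 ≤ d) : 1 / 2 < newBound d := by
  have hpos := newBound_pos (d := d) (by linarith)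
  have hright : 0 < 8 * (d + 1) * newBound d * (d + newBound d) := by positivity
  rw [← mul_newBound_sub_eq hd] at hright
  have := pos_of_mul_pos_right hright (by positivity)
  nlinarith

theorem mul_newBound_le (hd : 2 ≤ d) :
    7 * (3 * d + 1) * ((2 * d + 1) * newBound d) ≤ (d + 1) * (21 * d + 11) := by
  have hpos := newBound_pos (d := d) (by linarith)
  have hlt := newBound_lt_two_thirds hd
  have hexcess : 7 * (2 * d + 1) ^ 2 * ((2 * d + 1) * newBound d - (d + 1)) ≤
      8 * (d + 1) * (2 / 3) * (d + 2 / 3) := by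
    rw [mul_newBound_sub_eq hd]
    gcongr
  have hscaled : (2 * d + 1) ^ 2 * (7 * (3 * d + 1) * ((2 * d + 1) * newBound d - (d + 1))) ≤
      (2 * d + 1) ^ 2 * (4 * (d + 1)) := by
    calc (2 * d + 1) ^ 2 * (7 * (3 * d + 1) * ((2 * d + 1) * newBound d - (d + 1)))
        = (3 * d + 1) * (7 * (2 * d + 1) ^ 2 * ((2 * d + 1) * newBound d - (d + 1))) := by ring
      _ ≤ (3 * d + 1) * (8 * (d + 1) * (2 / 3) * (d + 2 / 3)) := by gcongr
      _ ≤ (2 * d + 1) ^ 2 * (4 * (d + 1)) := by nlinarith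
  linarith [le_of_mul_le_mul_left hscaled (by positivity)]

theorem le_add_mul_sub_sq {p : ℝ} (hd : 0 ≤ d) (hp : 1 / 3 ≤ p) (hp' : p ≤ 2 / 3) :
    d ^ 2 + 2 / 9 * d - 8 / 27 ≤ (d + p) * (d - p ^ 2) := by
  have hvar : 0 ≤ d * ((p - 1 / 3) * (2 / 3 - p)) :=
    mul_nonneg hd (mul_nonneg (sub_nonneg.2 hp) (sub_nonneg.2 hp'))
  have hcube : p ^ 3 ≤ (2 / 3) ^ 3 := by gcongr
  linarith

theorem sq_mul_sq_lt_of_mul_le {p u : ℝ} (hd : 2 ≤ d) (hp : 1 / 3 ≤ p) (hp' : p ≤ 2 / 3)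
    (hu0 : 0 ≤ u) (hu : 7 * (3 * d + 1) * u ≤ (d + 1) * (21 * d + 11)) :
    7 * (d ^ 2 * u ^ 2) < 8 * (d + 1) ^ 2 * ((d + p) * (d - p ^ 2)) := by
  have hquartic :
      7 * d ^ 2 * (21 * d + 11) ^ 2 <
        392 * (3 * d + 1) ^ 2 * (d ^ 2 + 2 / 9 * d - 8 / 27) := by
    obtain ⟨e, he, rfl⟩ : ∃ e, 0 ≤ e ∧ d = 2 + e := ⟨d - 2, by linarith, by ring⟩
    rw [← sub_pos]
    ring_nf
    positivity
  have hscaled : 49 * (3 * d + 1) ^ 2 * (7 * (d ^ 2 * u ^ 2)) <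
      49 * (3 * d + 1) ^ 2 * (8 * (d + 1) ^ 2 * ((d + p) * (d - p ^ 2))) := by
    calc 49 * (3 * d + 1) ^ 2 * (7 * (d ^ 2 * u ^ 2))
        = 7 * d ^ 2 * (7 * (3 * d + 1) * u) ^ 2 := by ring
      _ ≤ 7 * d ^ 2 * ((d + 1) * (21 * d + 11)) ^ 2 := by gcongr
      _ = (d + 1) ^ 2 * (7 * d ^ 2 * (21 * d + 11) ^ 2) := by ring
      _ < (d + 1) ^ 2 * (392 * (3 * d + 1) ^ 2 * (d ^ 2 + 2 / 9 * d - 8 / 27)) := by gcongr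
      _ ≤ (d + 1) ^ 2 * (392 * (3 * d + 1) ^ 2 * ((d + p) * (d - p ^ 2))) := by
          gcongr
          exact le_add_mul_sub_sq (by linarith) hp hp'
      _ = 49 * (3 * d + 1) ^ 2 * (8 * (d + 1) ^ 2 * ((d + p) * (d - p ^ 2))) := by ring
  exact lt_of_mul_lt_mul_left hscaled (by positivity)

theorem sq_mul_newBound_cube_lt (hd : 2 ≤ d) :
    d ^ 2 * newBound d ^ 3 <
      (d + 1) * ((2 * d + 1) * newBound d - (d + 1)) * (d - newBound d ^ 2) := by
  have hpos := newBound_pos (d := d) (by linarith)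
  have hmain := sq_mul_sq_lt_of_mul_le hd (by linarith [half_lt_newBound hd])
    (newBound_lt_two_thirds hd).le (by positivity) (mul_newBound_le hd)
  have hscaled : 7 * (2 * d + 1) ^ 2 * (d ^ 2 * newBound d ^ 3) < 7 * (2 * d + 1) ^ 2 *
      ((d + 1) * ((2 * d + 1) * newBound d - (d + 1)) * (d - newBound d ^ 2)) := by
    calc 7 * (2 * d + 1) ^ 2 * (d ^ 2 * newBound d ^ 3)
        = newBound d * (7 * (d ^ 2 * ((2 * d + 1) * newBound d) ^ 2)) := by ring
      _ < newBound d * (8 * (d + 1) ^ 2 * ((d + newBound d) * (d - newBound d ^ 2))) := by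
          gcongr
      _ = 7 * (2 * d + 1) ^ 2 *
          ((d + 1) * ((2 * d + 1) * newBound d - (d + 1)) * (d - newBound d ^ 2)) := by
          linear_combination -((d + 1) * (d - newBound d ^ 2)) * mul_newBound_sub_eq hd
  exact lt_of_mul_lt_mul_left hscaled (by positivity)

theorem newBoundPoly_oldBound_neg (hd : 2 ≤ d) : newBoundPoly d (oldBound d) < 0 := by
  have hsqrt : √(4 * d ^ 2 - 3) ^ 2 = 4 * d ^ 2 - 3 := Real.sq_sqrt (by nlinarith)
  have hroot : oldBound d ^ 2 = (2 * d + 1) * oldBound d - (d + 1) := by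
    rw [oldBound]
    linear_combination (1 / 4) * hsqrt
  have hlower : 1 / 2 < oldBound d := by
    have : √(4 * d ^ 2 - 3) < 2 * d := (Real.sqrt_lt' (by linarith)).2 (by linarith)
    rw [oldBound]
    linarith
  have hupper : oldBound d ≤ 1 := by
    have : 2 * d - 1 ≤ √(4 * d ^ 2 - 3) := Real.le_sqrt_of_sq_le (by linarith)
    rw [oldBound]
    linarith
  have hlt : 8 * (d + 1) * (d + oldBound d) < 7 * (2 * d + 1) ^ 2 * oldBound d := by
    calc 8 * (d + 1) * (d + oldBound d) ≤ 8 * (d + 1) * (d + 1) := by gcongr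
      _ < 7 * (2 * d + 1) ^ 2 * (1 / 2) := by nlinarith
      _ < 7 * (2 * d + 1) ^ 2 * oldBound d := by gcongr
  have hfactor : newBoundPoly d (oldBound d) =
      oldBound d * (8 * (d + 1) * (d + oldBound d) - 7 * (2 * d + 1) ^ 2 * oldBound d) := by
    rw [newBoundPoly]
    linear_combination 7 * (2 * d + 1) ^ 2 * hroot
  rw [hfactor]
  exact mul_neg_of_pos_of_neg (by linarith) (sub_neg.2 hlt)

theorem newBound_two_lt : newBound 2 < 0.648046 :=
  newBound_lt_of_newBoundPoly_neg two_pos (by norm_num [newBoundPoly])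

theorem lt_oldBound_two : 0.648046 < oldBound 2 := by
  have : √(4 * (2 : ℝ) ^ 2 - 3) < 3.7 := (Real.sqrt_lt' (by norm_num)).2 (by norm_num)
  rw [oldBound]
  linarith

end Bounds

theorem proposition3_general {d : ℕ} (hd : 2 ≤ d) :
    (safSurvivalSet d).Nonempty ∧ safCriticalParam d ≤ newBound d ∧ newBound d < oldBound d := by
  have hd2 : (2 : ℝ) ≤ d := by exact_mod_cast hd
  have hmem : newBound d ∈ safSurvivalSet d :=
    mem_safSurvivalSet hd (newBound_pos (by linarith))
      ((newBound_lt_two_thirds hd2).trans (by norm_num)) (sq_mul_newBound_cube_lt hd2)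
  exact ⟨⟨_, hmem⟩, safCriticalParam_le hmem,
    newBound_lt_of_newBoundPoly_neg (by linarith) (newBoundPoly_oldBound_neg hd2)⟩

theorem proposition3 :
    ((safSurvivalSet 2).Nonempty ∧ safCriticalParam 2 ≤ 0.648046 ∧ (0.648046 : ℝ) < oldBound 2) ∧
    ∀ d : ℕ, 3 ≤ d →
      (safSurvivalSet d).Nonempty ∧
      safCriticalParam d ≤ newBound d ∧
      newBound d < oldBound d := by
  have ⟨hnonempty, hle, _⟩ := proposition3_general (d := 2) le_rfl
  exact ⟨⟨hnonempty, hle.trans newBound_two_lt.le, lt_oldBound_two⟩,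
    fun d hd => proposition3_general (by omega)⟩
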